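/- Let $V$ be a real vector space of dimension $n+1$ with a symmetric bilinear form $B$ of signature $(n,1)$, and put $q(v)=B(v,v)$. Let $\Delta\subset V$ be a simple system: a finite set such that - if $\sum_{\alpha\in\Delta}\lambda_\alpha\alpha=0$ with all $\lambda_\alpha\ge 0$, then all $\lambda_\alpha=0$; - $B(\alpha,\beta)\in(-\infty,-1]\cup\{-\cos(\pi/k) : k\in\mathbb Z_{\ge 2}\}$ for all distinct $\alpha,\beta\in\Delta$; - $B(\alpha,\alpha)=1$ for all $\alpha\in\Delta$. Let $W\subset \mathrm{GL}(V)$ be the group generated by the reflections $s_\alpha(v)=v-2\frac{B(\alpha,v)}{B(\alpha,\alpha)}\alpha$, $\alpha\in\Delta$, and let $\Phi=W(\Delta)$, so that $(\Phi,\Delta)$ is a based root system in $(V,B)$. Fix a basis $(e_1,\dots,e_{n+1})$ of $V$ such that $q(v)=x_1^2+\dots+x_n^2-x_{n+1}^2$ in the corresponding coordinates, and such that $B(e_{n+1},\alpha)<0$ for all $\alpha\in\Delta$. Put $$\mathbb H^n=\{v\in V: q(v)=-1,\ x_{n+1}>0\},\qquad \mathbb H^n_p=\{v\in V: x_{n+1}=1,\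 x_1^2+\dots+x_n^2<1\},$$ and let $p:\mathbb H^n_p\to\mathbb H^n$, $p(v)=v/\sqrt{|q(v)|}$, be the radial projection. The group $W$ acts on $\mathbb H^n$ by restriction, and on $\mathbb H^n_p$ by $w\cdot v=p^{-1}(w(p(v)))$. Let $$C=\{v\in V: B(v,\alpha)\ge 0\ \text{ for all } \alpha\in\Delta\},\qquad \mathcal U=\bigcup_{w\in W}w(C)$$ be the fundamental chamber and the Tits cone. For an action of a group $G$ on a topological space $X$, a fundamental domain is a closed set $D\subset X$ which is the closure of its interior, such that the translates $gD$ cover $X$ and form a locally finite family, every $G$-orbit meets $D$ in exactly one point, and the interiors of $D$ and $gD$ are disjoint for every $g\neq 1$. Then: 1. $(-\mathcal U)\cap\mathbb H^n=\mathbb H^n$ and $(-\mathcal U)\cap\mathbb H^n_p=\mathbb H^n_p$. 2. $(-C)\cap\mathbb H^n$ is a fundamental domain for the action of $W$ on $\mathbb H^n$. 3. $(-C)\cap\mathbb H^n_p$ is a fundamental domain for the action of $W$ on $\mathbb H^n_p$. -/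

import Mathlib

open scoped Pointwise

namespace LorentzCoxeter

noncomputable section

/-! ### Lorentzian spaces, hyperboloid and projective models -/

section Lorentz

variable {V : Type*} [AddCommGroup V] [Module ℝ V] {n : ℕ}

/-- `b = (e₁, …, eₙ₊₁)` exhibits `(V, B)` as a Lorentzian `(n+1)`-space: `B` is a symmetric bilinear
form with `q(v) = B(v, v) = x₁² + ⋯ + xₙ² - xₙ₊₁²` in the coordinates given by `b`. A symmetric
bilinear form on `V` has signature `(n, 1)` if and only if such a basis exists. -/
structure IsLorentzBasis (B : LinearMap.BilinForm ℝ V) (b : Module.Basis (Fin (n + 1)) ℝ V) :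
    Prop where
  symm : ∀ u v, B u v = B v u
  quad : ∀ v, B v v = ∑ i : Fin n, b.repr v i.castSucc ^ 2 - b.repr v (Fin.last n) ^ 2

/-- The last coordinate `xₙ₊₁` of a vector. A vector is positive if this is `> 0`. -/
def lastCoord (b : Module.Basis (Fin (n + 1)) ℝ V) (v : V) : ℝ := b.repr v (Fin.last n)

/-- The hyperboloid model `ℍⁿ = {v | q(v) = -1, xₙ₊₁ > 0}`. It carries the subspace topology, which
is the topology of the hyperbolic distance `cosh d(x, y) = -B(x, y)`. -/
def hyperboloid (B : LinearMap.BilinForm ℝ V) (b : Module.Basis (Fin (n + 1)) ℝ V) : Set V :=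
  {v | B v v = -1 ∧ 0 < lastCoord b v}

/-- The projective model `ℍⁿₚ`, with underlying space the open unit ball
`{v | xₙ₊₁ = 1, x₁² + ⋯ + xₙ² < 1}` in the affine hyperplane `xₙ₊₁ = 1`. -/
def projModel (b : Module.Basis (Fin (n + 1)) ℝ V) : Set V :=
  {v | lastCoord b v = 1 ∧ ∑ i : Fin n, b.repr v i.castSucc ^ 2 < 1}

variable {B : LinearMap.BilinForm ℝ V} {b : Module.Basis (Fin (n + 1)) ℝ V}

@[simp] lemma lastCoord_smul (c : ℝ) (v : V) : lastCoord b (c • v) = c * lastCoord b v := by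
  simp [lastCoord]

lemma lastCoord_neg (v : V) : lastCoord b (-v) = -lastCoord b v := by
  simp [lastCoord]

lemma IsLorentzBasis.lastCoord_ne_zero (hb : IsLorentzBasis B b) {v : V} (hv : B v v < 0) :
    lastCoord b v ≠ 0 := by
  intro h
  have h2 : b.repr v (Fin.last n) = 0 := h
  rw [hb.quad, h2] at hv
  have : 0 ≤ ∑ i : Fin n, b.repr v i.castSucc ^ 2 := Finset.sum_nonneg fun i _ => sq_nonneg _
  linarith

lemma IsLorentzBasis.apply_eq (hb : IsLorentzBasis B b) (u v : V) :
    B u v = ∑ i : Fin n, b.repr u i.castSucc * b.repr v i.castSucc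
      - lastCoord b u * lastCoord b v := by
  have h1 := hb.quad (u + v)
  have h2 : B (u + v) (u + v) = B u u + B v v + 2 * B u v := by
    simp only [map_add, LinearMap.add_apply, hb.symm v u]; ring
  rw [h2, hb.quad u, hb.quad v] at h1
  have h3 : ∑ i : Fin n, b.repr (u + v) i.castSucc ^ 2 =
      ∑ i : Fin n, b.repr u i.castSucc ^ 2 + ∑ i : Fin n, b.repr v i.castSucc ^ 2
        + 2 * ∑ i : Fin n, b.repr u i.castSucc * b.repr v i.castSucc := by
    rw [Finset.mul_sum, ← Finset.sum_add_distrib, ← Finset.sum_add_distrib]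
    refine Finset.sum_congr rfl fun i _ => ?_
    simp only [map_add, Finsupp.add_apply]; ring
  have h4 : b.repr (u + v) (Fin.last n) ^ 2 = lastCoord b u ^ 2 + lastCoord b v ^ 2
      + 2 * (lastCoord b u * lastCoord b v) := by
    simp only [map_add, Finsupp.add_apply, lastCoord]; ring
  rw [h3, h4] at h1
  simp only [lastCoord] at h1 ⊢
  linarith

lemma IsLorentzBasis.pos_of_apply_neg (hb : IsLorentzBasis B b) {u v : V} (hu : B u u < 0)
    (hu' : 0 < lastCoord b u) (hv : B v v < 0) (huv : B u v < 0) : 0 < lastCoord b v := by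
  by_contra hcon
  have hneg : lastCoord b v < 0 := lt_of_le_of_ne (not_lt.mp hcon) (hb.lastCoord_ne_zero hv)
  have hcs := Finset.sum_mul_sq_le_sq_mul_sq Finset.univ
    (fun i : Fin n => b.repr u i.castSucc) (fun i : Fin n => b.repr v i.castSucc)
  rw [hb.apply_eq] at huv
  rw [hb.quad] at hu hv
  have h1 : 0 ≤ ∑ i : Fin n, b.repr u i.castSucc ^ 2 := Finset.sum_nonneg fun i _ => sq_nonneg _
  have h2 : 0 ≤ ∑ i : Fin n, b.repr v i.castSucc ^ 2 := Finset.sum_nonneg fun i _ => sq_nonneg _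
  change _ - lastCoord b u ^ 2 < 0 at hu
  change _ - lastCoord b v ^ 2 < 0 at hv
  have h3 : lastCoord b u * lastCoord b v < 0 := mul_neg_of_pos_of_neg hu' hneg
  have h4 : (∑ i : Fin n, b.repr u i.castSucc ^ 2) * (∑ i : Fin n, b.repr v i.castSucc ^ 2)
      ≤ lastCoord b u ^ 2 * lastCoord b v ^ 2 :=
    mul_le_mul (by linarith) (by linarith) h2 (sq_nonneg _)
  nlinarith

/-- The group `O_B⁺(V)` of positive Lorentz transformations: linear automorphisms that preserve `B`
and map positive time-like vectors to positive time-like vectors. -/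
def posLorentz (hb : IsLorentzBasis B b) : Subgroup (V ≃ₗ[ℝ] V) where
  carrier := {f | (∀ u v, B (f u) (f v) = B u v) ∧
    ∀ v, B v v < 0 → 0 < lastCoord b v → 0 < lastCoord b (f v)}
  one_mem' := ⟨fun _ _ => rfl, fun _ _ h => h⟩
  mul_mem' := by
    rintro f g ⟨hf, hf'⟩ ⟨hg, hg'⟩
    refine ⟨fun u v => ?_, fun v hv hv' => ?_⟩
    · rw [LinearEquiv.mul_apply, LinearEquiv.mul_apply, hf, hg]
    · exact hf' (g v) (lt_of_eq_of_lt (hg v v) hv) (hg' v hv hv')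
  inv_mem' := by
    rintro f ⟨hf, hf'⟩
    have hff : ∀ v, f (f⁻¹ v) = v := fun v => LinearEquiv.apply_symm_apply f v
    have hinv : ∀ u v, B (f⁻¹ u) (f⁻¹ v) = B u v := fun u v => by
      rw [← hf, hff, hff]
    refine ⟨hinv, fun v hv hv' => ?_⟩
    by_contra hcon
    have hq : B (f⁻¹ v) (f⁻¹ v) < 0 := by rw [hinv]; exact hv
    have hlt : lastCoord b (f⁻¹ v) < 0 :=
      lt_of_le_of_ne (not_lt.mp hcon) (hb.lastCoord_ne_zero hq)
    have h := hf' (-(f⁻¹ v)) (by simpa using hq) (by rw [lastCoord_neg]; linarith)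
    rw [map_neg, hff, lastCoord_neg] at h
    linarith

/-- `O_B⁺(V)` acts on `ℍⁿ` by restriction. -/
instance (hb : IsLorentzBasis B b) : MulAction (posLorentz hb) (hyperboloid B b) where
  smul f v := ⟨f.1 v.1, by
    refine ⟨by rw [f.2.1]; exact v.2.1, f.2.2 _ ?_ v.2.2⟩
    rw [v.2.1]; norm_num⟩
  one_smul _ := rfl
  mul_smul _ _ _ := rfl

lemma IsLorentzBasis.quad_projModel (hb : IsLorentzBasis B b) {v : V} (hv : v ∈ projModel b) :
    B v v < 0 := by
  have h1 : b.repr v (Fin.last n) = 1 := hv.1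
  have h2 := hv.2
  rw [hb.quad, h1]; linarith

/-- The radial projection `p : ℍⁿₚ → ℍⁿ`, `p(v) = v / √|q(v)|`, with inverse
`p⁻¹(v) = v / xₙ₊₁`. -/
def radialProjection (hb : IsLorentzBasis B b) : projModel b ≃ hyperboloid B b where
  toFun v := ⟨(√|B v.1 v.1|)⁻¹ • v.1, by
    have hq := hb.quad_projModel v.2
    have hs : 0 < √|B v.1 v.1| := Real.sqrt_pos.mpr (abs_pos.mpr hq.ne)
    have hss : √|B v.1 v.1| * √|B v.1 v.1| = -B v.1 v.1 := by
      rw [Real.mul_self_sqrt (abs_nonneg _), abs_of_neg hq]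
    refine ⟨?_, ?_⟩
    · simp only [map_smul, LinearMap.smul_apply, smul_eq_mul]
      have : B v.1 v.1 = -(√|B v.1 v.1| * √|B v.1 v.1|) := by linarith
      generalize √|B v.1 v.1| = s at *
      rw [this]; field_simp
    · rw [lastCoord_smul, v.2.1, mul_one]; exact inv_pos.mpr hs⟩
  invFun v := ⟨(lastCoord b v.1)⁻¹ • v.1, by
    have hx := v.2.2
    refine ⟨by rw [lastCoord_smul, inv_mul_cancel₀ hx.ne'], ?_⟩
    have h := v.2.1
    rw [hb.quad] at h
    change _ - lastCoord b v.1 ^ 2 = -1 at h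
    simp only [map_smul, Finsupp.smul_apply, smul_eq_mul, mul_pow]
    rw [← Finset.mul_sum, inv_pow, inv_mul_lt_iff₀ (by positivity)]
    linarith⟩
  left_inv v := by
    have hq := hb.quad_projModel v.2
    have hs : 0 < √|B v.1 v.1| := Real.sqrt_pos.mpr (abs_pos.mpr hq.ne)
    apply Subtype.ext
    simp only [lastCoord_smul, v.2.1, smul_smul]
    rw [mul_one, inv_inv, mul_inv_cancel₀ hs.ne', one_smul]
  right_inv v := by
    have hx := v.2.2
    apply Subtype.ext
    simp only [map_smul, LinearMap.smul_apply, smul_eq_mul, v.2.1, smul_smul]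
    have : |(lastCoord b v.1)⁻¹ * ((lastCoord b v.1)⁻¹ * -1)| = (lastCoord b v.1)⁻¹ ^ 2 := by
      rw [show (lastCoord b v.1)⁻¹ * ((lastCoord b v.1)⁻¹ * -1) = -((lastCoord b v.1)⁻¹ ^ 2) by ring,
        abs_neg, abs_of_nonneg (sq_nonneg _)]
    rw [this, Real.sqrt_sq (inv_nonneg.mpr hx.le), inv_inv, mul_inv_cancel₀ hx.ne', one_smul]

/-! ### Based root systems -/

/-- The `B`-reflection `s_α(v) = v - 2 B(α, v) / B(α, α) α` in a non-isotropic vector `α`. -/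
def reflection (B : LinearMap.BilinForm ℝ V) (α : V) (hα : B α α ≠ 0) : V ≃ₗ[ℝ] V :=
  Module.reflection (x := α) (f := (2 / B α α) • B α) (by simp [hα])

lemma reflection_apply (B : LinearMap.BilinForm ℝ V) (α : V) (hα : B α α ≠ 0) (v : V) :
    reflection B α hα v = v - (2 * (B α v / B α α)) • α := by
  simp only [reflection, Module.reflection_apply, LinearMap.smul_apply, smul_eq_mul]
  congr 2; ring

/-- Simple systems: finite, positively independent sets of vectors of norm `1` whose pairwise
products lie in `(-∞, -1] ∪ {-cos(π/k) | k ≥ 2}`. -/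
structure IsSimpleSystem (B : LinearMap.BilinForm ℝ V) (Δ : Finset V) : Prop where
  pos_indep : ∀ c : V → ℝ, (∀ α ∈ Δ, 0 ≤ c α) → ∑ α ∈ Δ, c α • α = 0 → ∀ α ∈ Δ, c α = 0
  apply_ne : ∀ α ∈ Δ, ∀ β ∈ Δ, α ≠ β →
    B α β ≤ -1 ∨ ∃ k : ℕ, 2 ≤ k ∧ B α β = -Real.cos (Real.pi / k)
  apply_self : ∀ α ∈ Δ, B α α = 1

/-- The group `W` generated by the set `S` of `B`-reflections in the elements of `Δ`. -/
def coxeterGroup (B : LinearMap.BilinForm ℝ V) (Δ : Finset V) : Subgroup (V ≃ₗ[ℝ] V) :=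
  Subgroup.closure {s | ∃ α ∈ Δ, ∃ hα : B α α ≠ 0, s = reflection B α hα}

/-- `(Φ, Δ)` is a based root system in `(V, B)`: `Δ` is a simple system and `Φ = W(Δ)`. -/
structure IsBasedRootSystem (B : LinearMap.BilinForm ℝ V) (Φ : Set V) (Δ : Finset V) : Prop where
  simple : IsSimpleSystem B Δ
  roots_eq : Φ = {v | ∃ w ∈ coxeterGroup B Δ, ∃ α ∈ Δ, v = w α}

/-- The fundamental chamber `C = {v | B(v, α) ≥ 0 for all α ∈ Δ}`. -/
def chamber (B : LinearMap.BilinForm ℝ V) (Δ : Finset V) : Set V :=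
  {v | ∀ α ∈ Δ, 0 ≤ B v α}

/-- The Tits cone `𝒰`, the union of the `W`-translates of `C`. -/
def titsCone (B : LinearMap.BilinForm ℝ V) (Δ : Finset V) : Set V :=
  ⋃ w ∈ coxeterGroup B Δ, w '' chamber B Δ

/-- `W` consists of positive Lorentz transformations. -/
theorem coxeterGroup_le (hb : IsLorentzBasis B b) {Δ : Finset V} (hΔ : IsSimpleSystem B Δ) :
    coxeterGroup B Δ ≤ posLorentz hb := by
  rw [coxeterGroup, Subgroup.closure_le]
  rintro s ⟨α, hα, h0, rfl⟩
  have h1 := hΔ.apply_self α hα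
  have hpres : ∀ u v, B (reflection B α h0 u) (reflection B α h0 v) = B u v := by
    intro u v
    simp only [reflection_apply, h1, map_sub, map_smul, LinearMap.sub_apply, LinearMap.smul_apply,
      smul_eq_mul, hb.symm u α]
    ring
  refine ⟨hpres, fun v hv hv' => ?_⟩
  refine hb.pos_of_apply_neg hv hv' (by rw [hpres]; exact hv) ?_
  simp only [reflection_apply, h1, map_sub, map_smul, smul_eq_mul, hb.symm v α]
  nlinarith [sq_nonneg (B α v)]

/-- The action of `W` on `ℍⁿ`, by restriction of its linear action on `V`. -/
def hyperboloidAction (hb : IsLorentzBasis B b) {Δ : Finset V} (hΔ : IsSimpleSystem B Δ) :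
    coxeterGroup B Δ →* Equiv.Perm (hyperboloid B b) :=
  (MulAction.toPermHom (posLorentz hb) (hyperboloid B b)).comp
    (Subgroup.inclusion (coxeterGroup_le hb hΔ))

/-- The projective action of `W` on `ℍⁿₚ`: `w · v = p⁻¹(w(p(v)))`. -/
def projAction (hb : IsLorentzBasis B b) {Δ : Finset V} (hΔ : IsSimpleSystem B Δ) :
    coxeterGroup B Δ →* Equiv.Perm (projModel b) :=
  (radialProjection hb).symm.permCongrHom.toMonoidHom.comp (hyperboloidAction hb hΔ)

lemma hyperboloidAction_apply (hb : IsLorentzBasis B b) {Δ : Finset V} (hΔ : IsSimpleSystem B Δ)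
    (w : coxeterGroup B Δ) (v : hyperboloid B b) :
    (hyperboloidAction hb hΔ w v : V) = w.1 v.1 := rfl

lemma projAction_apply (hb : IsLorentzBasis B b) {Δ : Finset V} (hΔ : IsSimpleSystem B Δ)
    (w : coxeterGroup B Δ) (v : projModel b) :
    projAction hb hΔ w v =
      (radialProjection hb).symm (hyperboloidAction hb hΔ w (radialProjection hb v)) := rfl

/-- In terms of `V`, the point `w · v` is the intersection of the line `ℝ w(v)` with `ℍⁿₚ`. -/
lemma coe_projAction_apply (hb : IsLorentzBasis B b) {Δ : Finset V} (hΔ : IsSimpleSystem B Δ)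
    (w : coxeterGroup B Δ) (v : projModel b) :
    (projAction hb hΔ w v : V) = (lastCoord b (w.1 v.1))⁻¹ • w.1 v.1 := by
  have hq := hb.quad_projModel v.2
  have hs : 0 < √|B v.1 v.1| := Real.sqrt_pos.mpr (abs_pos.mpr hq.ne)
  change (lastCoord b (w.1 ((√|B v.1 v.1|)⁻¹ • v.1)))⁻¹ • w.1 ((√|B v.1 v.1|)⁻¹ • v.1) = _
  rw [map_smul, lastCoord_smul, smul_smul, mul_inv, inv_inv, mul_right_comm,
    mul_inv_cancel₀ hs.ne', one_mul]

end Lorentz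

/-- A subset `D` of a topological space `X` is a fundamental domain for an action `ρ` of a group `G`
on `X`: it is a closed domain (a closed set that is the closure of its interior), every orbit meets
`D` in exactly one point, the interiors of `D` and of its translate by `g ≠ 1` are disjoint, and the
family of translates of `D` (which covers `X`) is locally finite. -/
structure IsFundamentalDomain {X G : Type*} [TopologicalSpace X] [Group G]
    (ρ : G →* Equiv.Perm X) (D : Set X) : Prop where
  isClosed : IsClosed D
  closure_interior : closure (interior D) = D
  covers : ⋃ g, ρ g '' D = Set.univ
  unique : ∀ x ∈ D, ∀ g, ρ g x ∈ D → ρ g x = x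
  disjoint : ∀ g, g ≠ 1 → Disjoint (interior D) (ρ g '' interior D)
  locallyFinite : LocallyFinite fun g => ρ g '' D

end

end LorentzCoxeter

/-! Everything follows from one inequality. For `x` in `C` and `w` in `W`, the difference `x - w x`
pairs nonnegatively with `C` (`sub_apply_mem_dualCone`). If `w ≠ 1`, this remains true after
subtracting the contribution `2 B(α, x) α` of the first letter `α` of a reduced word of `w`
(`exists_sub_apply_mem_dualCone`).

The inequality is a telescoping sum along a reduced word, with nonnegative multiples of roots as
terms. These roots are positive by `apply_mem_dualCone`, an induction on length that splits off a
maximal dihedral factor, where roots have Chebyshev values as coefficients. Positivity means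
membership in the dual cone of `C`, so no linear independence of `Δ` is needed.

Write `e` for the last basis vector; `-e` is interior to `C`. Evaluated at `-e`, the sharp
inequality separates the points `w e` uniformly, so only finitely many `w` have `w e` of bounded
height, the height being the last coordinate (`finite_lastCoord_le`). Hence each orbit in `ℍⁿ` has a
lowest point, and it lies in `-C`, since reflecting in a violated wall would lower it. Local
finiteness follows from the same bound. If `x` and `w x` both lie in `-C`, applying the inequality
to `w` and to its inverse makes `w x - x` orthogonal to `C`, hence zero; the sharp form then gives
`w = 1` at interior points. The projective model inherits all this through the radial homeomorphism.
-/

namespace LorentzCoxeter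

noncomputable section

/-! ### Word length -/

section WordLength

variable {G ι : Type*} [Group G]

/-- The least length of a word in the family `s` with product `g`. -/
def wordLength (s : ι → G) (g : G) : ℕ :=
  sInf {N | ∃ l : List ι, l.length = N ∧ (l.map s).prod = g}

variable {s : ι → G}

lemma wordLength_prod_le (l : List ι) : wordLength s (l.map s).prod ≤ l.length :=
  Nat.sInf_le ⟨l, rfl, rfl⟩

lemma exists_word (hs : ∀ i, s i * s i = 1) {g : G} (hg : g ∈ Subgroup.closure (Set.range s)) :
    ∃ l : List ι, (l.map s).prod = g := by
  induction hg using Subgroup.closure_induction with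
  | mem x hx => obtain ⟨i, rfl⟩ := hx; exact ⟨[i], by simp⟩
  | one => exact ⟨[], by simp⟩
  | mul x y _ _ hx hy =>
    obtain ⟨l, rfl⟩ := hx
    obtain ⟨m, rfl⟩ := hy
    exact ⟨l ++ m, by simp⟩
  | inv x hmem hx =>
    obtain ⟨l, rfl⟩ := hx
    -- The letters are involutions, so the reversed word represents the inverse.
    refine ⟨l.reverse, ?_⟩
    clear hmem
    induction l with
    | nil => simp
    | cons i l ih =>
      simp only [List.reverse_cons, List.map_append, List.prod_append, ih, List.map_cons,
        List.map_nil, List.prod_cons, List.prod_nil, mul_one, mul_inv_rev]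
      rw [← eq_inv_of_mul_eq_one_left (hs i)]

/-- Membership in the closure makes the set of lengths nonempty; otherwise `sInf` would return the
default `0`. -/
lemma exists_reduced_word (hs : ∀ i, s i * s i = 1) {g : G}
    (hg : g ∈ Subgroup.closure (Set.range s)) :
    ∃ l : List ι, l.length = wordLength s g ∧ (l.map s).prod = g := by
  obtain ⟨l, hl⟩ := exists_word hs hg
  exact Nat.sInf_mem (s := {N | ∃ l : List ι, l.length = N ∧ (l.map s).prod = g})
    ⟨l.length, l, rfl, hl⟩

lemma wordLength_mul_prod_le (hs : ∀ i, s i * s i = 1) {g : G}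
    (hg : g ∈ Subgroup.closure (Set.range s)) (l : List ι) :
    wordLength s (g * (l.map s).prod) ≤ wordLength s g + l.length := by
  obtain ⟨m, hm, rfl⟩ := exists_reduced_word hs hg
  rw [← hm, ← List.prod_append, ← List.map_append, ← List.length_append]
  exact wordLength_prod_le _

lemma prod_mem_closure (l : List ι) : (l.map s).prod ∈ Subgroup.closure (Set.range s) := by
  refine Subgroup.list_prod_mem _ fun x hx => ?_
  obtain ⟨i, -, rfl⟩ := List.mem_map.mp hx
  exact Subgroup.subset_closure ⟨i, rfl⟩

/-- The letters of an alternating word, counted from the right and starting at `1`. -/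
def altLetter (i j : ι) (m : ℕ) : ι := if Even m then i else j

lemma altLetter_add_two (i j : ι) (m : ℕ) : altLetter i j (m + 2) = altLetter i j m := by
  simp [altLetter, Nat.even_add]

/-- The alternating word of length `m` in `i` and `j` that ends in `j`. -/
def altWord (i j : ι) : ℕ → List ι
  | 0 => []
  | m + 1 => altLetter i j (m + 1) :: altWord i j m

@[simp] lemma length_altWord (i j : ι) (m : ℕ) : (altWord i j m).length = m := by
  induction m with
  | zero => rfl
  | succ m ih => simp [altWord, ih]

/-- The alternating product of `m` factors `s i` and `s j` that ends in `s j`. -/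
def altProd (s : ι → G) (i j : ι) (m : ℕ) : G := ((altWord i j m).map s).prod

lemma altProd_zero (i j : ι) : altProd s i j 0 = 1 := by simp [altProd, altWord]

lemma altProd_succ (i j : ι) (m : ℕ) :
    altProd s i j (m + 1) = s (altLetter i j (m + 1)) * altProd s i j m := by
  simp [altProd, altWord]

/-- After a braid relation `altProd s i j (k + 1) = altProd s i j k * s i`, all longer alternating
products can be shortened by multiplication with `s i`. -/
lemma exists_word_altProd_mul (hs : ∀ i, s i * s i = 1) {i j : ι} {k : ℕ}
    (hk : altProd s i j (k + 1) = altProd s i j k * s i) (m : ℕ) :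
    ∃ l : List ι, l.length = k + m ∧ (l.map s).prod = altProd s i j (k + 1 + m) * s i := by
  induction m with
  | zero => exact ⟨altWord i j k, by simp, by rw [add_zero, hk, mul_assoc, hs, mul_one, altProd]⟩
  | succ m ih =>
    obtain ⟨l, hl, hl'⟩ := ih
    refine ⟨altLetter i j (k + 1 + m + 1) :: l, by simp [hl, add_assoc], ?_⟩
    rw [List.map_cons, List.prod_cons, hl', ← add_assoc, altProd_succ, mul_assoc]

/-- Every `g` with a descent at `j` has a factorization `g = v * u` with additive lengths, where `u`
is an alternating product in `s i`, `s j` and `v` has no descent at `i` or `j`. -/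
lemma exists_alternating_factor (hs : ∀ i, s i * s i = 1) {g : G}
    (hg : g ∈ Subgroup.closure (Set.range s)) {i j : ι}
    (hj : wordLength s (g * s j) < wordLength s g) :
    ∃ v ∈ Subgroup.closure (Set.range s), ∃ m : ℕ, g = v * altProd s i j m ∧
      wordLength s v + m = wordLength s g ∧ 0 < m ∧
      wordLength s v ≤ wordLength s (v * s i) ∧ wordLength s v ≤ wordLength s (v * s j) := by
  classical
  have hmem : ∀ i, s i ∈ Subgroup.closure (Set.range s) := fun i =>
    Subgroup.subset_closure ⟨i, rfl⟩
  let Q : ℕ → Prop := fun m => ∃ v ∈ Subgroup.closure (Set.range s),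
    g = v * altProd s i j m ∧ wordLength s v + m = wordLength s g
  have hle : ∀ v ∈ Subgroup.closure (Set.range s), ∀ m, g = v * altProd s i j m →
      wordLength s g ≤ wordLength s v + m := fun v hv m h => by
    have := wordLength_mul_prod_le hs hv (altWord i j m)
    rw [length_altWord] at this
    rwa [h]
  have h1 : Q 1 := by
    have hfac : g = g * s j * altProd s i j 1 := by
      rw [altProd_succ, altProd_zero]
      simp [altLetter, mul_assoc, hs]
    refine ⟨g * s j, mul_mem hg (hmem j), hfac, ?_⟩
    have := hle _ (mul_mem hg (hmem j)) 1 hfac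
    omega
  have hb : ∀ m, Q m → m ≤ wordLength s g := fun m ⟨v, _, _, h⟩ => by omega
  -- Take the longest alternating suffix that can be split off with additive lengths.
  have hQ : Q (Nat.findGreatest Q (wordLength s g)) := Nat.findGreatest_spec (hb 1 h1) h1
  have hmax : ∀ m, Nat.findGreatest Q (wordLength s g) < m → ¬ Q m := fun m hm hQm =>
    absurd (Nat.le_findGreatest (hb m hQm) hQm) (not_le.mpr hm)
  have hpos : 1 ≤ Nat.findGreatest Q (wordLength s g) := Nat.le_findGreatest (hb 1 h1) h1
  generalize Nat.findGreatest Q (wordLength s g) = m at *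
  obtain ⟨v, hv, hgv, hlen⟩ := hQ
  obtain ⟨m, rfl⟩ := Nat.exists_eq_add_of_le' hpos
  -- The suffix now has length `m + 1`. A descent of `v` at the next letter would lengthen it,
  -- against maximality; a descent at its leading letter, excluded in `key2`, would make `g` too
  -- short.
  have key1 : wordLength s v ≤ wordLength s (v * s (altLetter i j (m + 2))) := by
    by_contra! hlt
    have hfac : g = v * s (altLetter i j (m + 2)) * altProd s i j (m + 2) := by
      rw [altProd_succ, mul_assoc, ← mul_assoc (s _) (s _), hs, one_mul, hgv]
    refine hmax (m + 2) (by omega) ⟨_, mul_mem hv (hmem _), hfac, ?_⟩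
    have := hle _ (mul_mem hv (hmem _)) _ hfac
    omega
  have key2 : wordLength s v ≤ wordLength s (v * s (altLetter i j (m + 1))) := by
    by_contra! hlt
    have hfac : g = v * s (altLetter i j (m + 1)) * altProd s i j m := by
      rw [hgv, altProd_succ, mul_assoc]
    have := hle _ (mul_mem hv (hmem _)) _ hfac
    omega
  refine ⟨v, hv, m + 1, hgv, hlen, by omega, ?_⟩
  by_cases hm : Even m
  · have e1 : altLetter i j (m + 2) = i := by simp [altLetter, Nat.even_add, hm]
    have e2 : altLetter i j (m + 1) = j := by simp [altLetter, Nat.even_add, hm]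
    rw [e1] at key1; rw [e2] at key2
    exact ⟨key1, key2⟩
  · have e1 : altLetter i j (m + 2) = j := by simp [altLetter, Nat.even_add, hm]
    have e2 : altLetter i j (m + 1) = i := by simp [altLetter, Nat.even_add, hm]
    rw [e1] at key1; rw [e2] at key2
    exact ⟨key2, key1⟩

end WordLength

/-! ### The dihedral recursion -/

/-- The sequence `0, 1, 2c, …` of Chebyshev values that describes products of two reflections. -/
def dihedralCoeff (c : ℝ) : ℕ → ℝ
  | 0 => 0
  | 1 => 1
  | m + 2 => 2 * c * dihedralCoeff c (m + 1) - dihedralCoeff c m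

/-- For `c ≥ 1` the recursion keeps the sequence nondecreasing, so monotonicity is carried through
the induction. -/
lemma dihedralCoeff_nonneg_of_one_le {c : ℝ} (hc : 1 ≤ c) (m : ℕ) : 0 ≤ dihedralCoeff c m := by
  suffices h : 0 ≤ dihedralCoeff c m ∧ dihedralCoeff c m ≤ dihedralCoeff c (m + 1) from h.1
  induction m with
  | zero => simp [dihedralCoeff]
  | succ m ih =>
    refine ⟨ih.1.trans ih.2, ?_⟩
    rw [dihedralCoeff]
    nlinarith [ih.1.trans ih.2]

lemma dihedralCoeff_cos (θ : ℝ) (m : ℕ) :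
    dihedralCoeff (Real.cos θ) m * Real.sin θ = Real.sin (m * θ) := by
  induction m using Nat.twoStepInduction with
  | zero => simp [dihedralCoeff]
  | one => simp [dihedralCoeff]
  | more m h0 h1 =>
    rw [dihedralCoeff, sub_mul, h0, mul_assoc, h1]
    push_cast
    rw [show ((m : ℝ) + 2) * θ = (m + 1) * θ + θ by ring,
      show (m : ℝ) * θ = (m + 1) * θ - θ by ring, Real.sin_add, Real.sin_sub]
    ring

section CosPiDiv

variable {k : ℕ}

lemma sin_pi_div_pos (hk : 2 ≤ k) : 0 < Real.sin (Real.pi / k) := by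
  have hk' : (2 : ℝ) ≤ k := by exact_mod_cast hk
  refine Real.sin_pos_of_pos_of_lt_pi (by positivity) ?_
  rw [div_lt_iff₀ (by linarith)]
  nlinarith [Real.pi_pos]

lemma dihedralCoeff_nonneg_of_le (hk : 2 ≤ k) {m : ℕ} (hm : m ≤ k) :
    0 ≤ dihedralCoeff (Real.cos (Real.pi / k)) m := by
  have hk' : (0 : ℝ) < k := by exact_mod_cast (by omega : 0 < k)
  have h := dihedralCoeff_cos (Real.pi / k) m
  have h2 : 0 ≤ Real.sin (m * (Real.pi / k)) := by
    refine Real.sin_nonneg_of_nonneg_of_le_pi (by positivity) ?_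
    rw [← mul_div_assoc, div_le_iff₀ hk', mul_comm]
    have : (m : ℝ) ≤ k := by exact_mod_cast hm
    nlinarith [Real.pi_pos]
  by_contra! hneg
  nlinarith [sin_pi_div_pos hk]

/-- Together with `dihedralCoeff_pred`, this shows that the alternating product of length `k - 1`
sends a simple root to a simple root, which yields the braid relation. -/
lemma dihedralCoeff_self (hk : 2 ≤ k) : dihedralCoeff (Real.cos (Real.pi / k)) k = 0 := by
  have hk' : (k : ℝ) ≠ 0 := by exact_mod_cast (by omega : k ≠ 0)
  have h := dihedralCoeff_cos (Real.pi / k) k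
  rw [mul_div_cancel₀ _ hk', Real.sin_pi] at h
  exact (mul_eq_zero.mp h).resolve_right (sin_pi_div_pos hk).ne'

lemma dihedralCoeff_pred (hk : 2 ≤ k) : dihedralCoeff (Real.cos (Real.pi / k)) (k - 1) = 1 := by
  have hk' : (k : ℝ) ≠ 0 := by exact_mod_cast (by omega : k ≠ 0)
  have h := dihedralCoeff_cos (Real.pi / k) (k - 1)
  rw [Nat.cast_sub (by omega), Nat.cast_one, sub_mul, mul_div_cancel₀ _ hk', one_mul,
    Real.sin_pi_sub] at h
  exact mul_right_cancel₀ (sin_pi_div_pos hk).ne' (h.trans (one_mul _).symm)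

end CosPiDiv

/-! ### Positivity of roots -/

section Roots

variable {V : Type*} [AddCommGroup V] [Module ℝ V] {B : LinearMap.BilinForm ℝ V} {Δ : Finset V}

/-- The cone dual to the fundamental chamber. It contains the positive roots. -/
def dualCone (B : LinearMap.BilinForm ℝ V) (Δ : Finset V) : Set V :=
  {v | ∀ y ∈ chamber B Δ, 0 ≤ B y v}

lemma mem_dualCone {α : V} (hα : α ∈ Δ) : α ∈ dualCone B Δ := fun _ hy => hy α hα

lemma zero_mem_dualCone : (0 : V) ∈ dualCone B Δ := fun y _ => by simp

lemma add_mem_dualCone {u v : V} (hu : u ∈ dualCone B Δ) (hv : v ∈ dualCone B Δ) :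
    u + v ∈ dualCone B Δ := fun y hy => by
  rw [map_add]; exact add_nonneg (hu y hy) (hv y hy)

lemma smul_mem_dualCone {c : ℝ} (hc : 0 ≤ c) {v : V} (hv : v ∈ dualCone B Δ) :
    c • v ∈ dualCone B Δ := fun y hy => by
  rw [map_smul, smul_eq_mul]; exact mul_nonneg hc (hv y hy)

namespace IsSimpleSystem

lemma apply_self_ne (hΔ : IsSimpleSystem B Δ) (α : Δ) : B (α : V) α ≠ 0 := by
  rw [hΔ.apply_self α α.2]; exact one_ne_zero

/-- The reflection in a simple root. -/
def simpleReflection (hΔ : IsSimpleSystem B Δ) (α : Δ) : V ≃ₗ[ℝ] V :=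
  reflection B α (hΔ.apply_self_ne α)

lemma simpleReflection_apply (hΔ : IsSimpleSystem B Δ) (α : Δ) (v : V) :
    hΔ.simpleReflection α v = v - (2 * B α v) • (α : V) := by
  rw [simpleReflection, reflection_apply, hΔ.apply_self α α.2, div_one]

lemma simpleReflection_mul_self (hΔ : IsSimpleSystem B Δ) (α : Δ) :
    hΔ.simpleReflection α * hΔ.simpleReflection α = 1 := by
  ext v
  simp only [LinearEquiv.mul_apply, simpleReflection_apply, map_sub, map_smul,
    hΔ.apply_self α α.2, LinearEquiv.coe_one, id_eq]
  module

lemma closure_range_simpleReflection (hΔ : IsSimpleSystem B Δ) :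
    Subgroup.closure (Set.range hΔ.simpleReflection) = coxeterGroup B Δ := by
  rw [coxeterGroup]
  congr 1
  ext f
  constructor
  · rintro ⟨α, rfl⟩; exact ⟨α, α.2, _, rfl⟩
  · rintro ⟨α, hα, h0, rfl⟩; exact ⟨⟨α, hα⟩, rfl⟩

lemma simpleReflection_mem (hΔ : IsSimpleSystem B Δ) (α : Δ) :
    hΔ.simpleReflection α ∈ coxeterGroup B Δ :=
  Subgroup.subset_closure ⟨α, α.2, _, rfl⟩

lemma apply_apply (hΔ : IsSimpleSystem B Δ) (hB : ∀ u v, B u v = B v u)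
    {w : V ≃ₗ[ℝ] V} (hw : w ∈ coxeterGroup B Δ) (u v : V) : B (w u) (w v) = B u v := by
  rw [← hΔ.closure_range_simpleReflection] at hw
  obtain ⟨l, rfl⟩ := exists_word hΔ.simpleReflection_mul_self hw
  induction l with
  | nil => rfl
  | cons α l ih =>
    rw [List.map_cons, List.prod_cons, LinearEquiv.mul_apply, LinearEquiv.mul_apply,
      ← ih (prod_mem_closure l)]
    generalize (List.map hΔ.simpleReflection l).prod u = x
    generalize (List.map hΔ.simpleReflection l).prod v = y
    simp only [simpleReflection_apply, map_sub, map_smul, LinearMap.sub_apply,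
      LinearMap.smul_apply, smul_eq_mul, hΔ.apply_self α α.2, hB x α]
    ring

lemma apply_inv_apply (hΔ : IsSimpleSystem B Δ) (hB : ∀ u v, B u v = B v u)
    {w : V ≃ₗ[ℝ] V} (hw : w ∈ coxeterGroup B Δ) (u v : V) : B (w⁻¹ u) v = B u (w v) := by
  rw [← hΔ.apply_apply hB hw, ← LinearEquiv.mul_apply, mul_inv_cancel, LinearEquiv.coe_one, id_eq]

/-- If `w` maps a simple root to another, it conjugates the reflections. -/
lemma simpleReflection_mul_of_apply_eq (hΔ : IsSimpleSystem B Δ) (hB : ∀ u v, B u v = B v u)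
    {w : V ≃ₗ[ℝ] V} (hw : w ∈ coxeterGroup B Δ) {α β : Δ} (h : w α = β) :
    hΔ.simpleReflection β * w = w * hΔ.simpleReflection α := by
  ext v
  simp only [LinearEquiv.mul_apply, simpleReflection_apply, map_sub, map_smul]
  rw [← h, hΔ.apply_apply hB hw]

/-- The next reflection changes only the coefficient of its own root, and that change is the
Chebyshev recursion with `c = -B α β`. -/
lemma altProd_apply (hΔ : IsSimpleSystem B Δ) (hB : ∀ u v, B u v = B v u) (α β : Δ) (m : ℕ) :
    altProd hΔ.simpleReflection α β m α =
      dihedralCoeff (-B α β) (m + 1) • ((altLetter α β m : Δ) : V) +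
        dihedralCoeff (-B α β) m • ((altLetter α β (m + 1) : Δ) : V) := by
  induction m with
  | zero => simp [altProd_zero, dihedralCoeff, altLetter]
  | succ m ih =>
    have hc : B ((altLetter α β (m + 1) : Δ) : V) ((altLetter α β m : Δ) : V) = B α β := by
      by_cases hm : Even m <;> simp [altLetter, Nat.even_add, hm, hB]
    rw [altProd_succ, LinearEquiv.mul_apply, ih, simpleReflection_apply, altLetter_add_two]
    simp only [map_add, map_smul, smul_eq_mul, hc, hΔ.apply_self _ (altLetter α β (m + 1)).2]
    rw [dihedralCoeff]
    module

lemma altProd_mem (hΔ : IsSimpleSystem B Δ) (α β : Δ) (m : ℕ) :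
    altProd hΔ.simpleReflection α β m ∈ coxeterGroup B Δ := by
  rw [← hΔ.closure_range_simpleReflection]; exact prod_mem_closure _

/-- A simple root that is not a descent of `w` is mapped to a positive root by `w`. -/
theorem apply_mem_dualCone (hΔ : IsSimpleSystem B Δ) (hB : ∀ u v, B u v = B v u)
    {w : V ≃ₗ[ℝ] V} (hw : w ∈ coxeterGroup B Δ) (α : Δ)
    (hα : wordLength hΔ.simpleReflection w ≤
      wordLength hΔ.simpleReflection (w * hΔ.simpleReflection α)) :
    w α ∈ dualCone B Δ := by
  have hs := hΔ.simpleReflection_mul_self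
  induction hN : wordLength hΔ.simpleReflection w using Nat.strong_induction_on
    generalizing w α with
  | _ N ih =>
  subst hN
  have hw' := hw
  rw [← hΔ.closure_range_simpleReflection] at hw'
  obtain ⟨l, hl, hlw⟩ := exists_reduced_word hs hw'
  rcases List.eq_nil_or_concat l with rfl | ⟨l', β, rfl⟩
  · rw [← hlw]
    exact mem_dualCone α.2
  -- The last letter of a reduced word is a descent.
  have hβ : wordLength hΔ.simpleReflection (w * hΔ.simpleReflection β) <
      wordLength hΔ.simpleReflection w := by
    rw [← hl, ← hlw]
    simp only [List.concat_eq_append, List.map_append, List.prod_append, List.map_cons,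
      List.map_nil, List.prod_cons, List.prod_nil, mul_one, mul_assoc, hs, List.length_append,
      List.length_cons, List.length_nil]
    exact Nat.lt_succ_of_le (wordLength_prod_le l')
  have hne : (α : V) ≠ β := by
    intro h
    rw [Subtype.ext h] at hα
    omega
  obtain ⟨v, hv, m, hfac, hlen, hm, hvα, hvβ⟩ := exists_alternating_factor (i := α) hs hw' hβ
  have hv' := hv
  rw [hΔ.closure_range_simpleReflection] at hv'
  have hvα := ih _ (by omega) hv' α hvα rfl
  have hvβ := ih _ (by omega) hv' β hvβ rfl
  have hletter : ∀ r, v (altLetter α β r : Δ) ∈ dualCone B Δ := fun r => by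
    rw [altLetter]; split_ifs <;> assumption
  rw [hfac, LinearEquiv.mul_apply, hΔ.altProd_apply hB, map_add, map_smul, map_smul]
  rcases hΔ.apply_ne α α.2 β β.2 hne with hle | ⟨k, hk, hcos⟩
  · exact add_mem_dualCone
      (smul_mem_dualCone (dihedralCoeff_nonneg_of_one_le (by linarith) _) (hletter _))
      (smul_mem_dualCone (dihedralCoeff_nonneg_of_one_le (by linarith) _) (hletter _))
  rw [hcos, neg_neg]
  rcases lt_or_ge m k with hmk | hmk
  · exact add_mem_dualCone
      (smul_mem_dualCone (dihedralCoeff_nonneg_of_le hk hmk) (hletter _))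
      (smul_mem_dualCone (dihedralCoeff_nonneg_of_le hk hmk.le) (hletter _))
  -- If the dihedral factor had length at least `k`, the braid relation would write its product with
  -- `s_α` as a word one letter shorter than the factor, so `α` would be a descent of `w`.
  exfalso
  obtain ⟨k, rfl⟩ : ∃ k', k = k' + 1 := ⟨k - 1, by omega⟩
  have hroot : altProd hΔ.simpleReflection α β k α =
      (altLetter α β (k + 1) : Δ) := by
    have h1 := dihedralCoeff_self hk
    have h2 := dihedralCoeff_pred hk
    rw [Nat.add_sub_cancel] at h2
    rw [hΔ.altProd_apply hB, hcos, neg_neg, h1, h2, zero_smul, one_smul, zero_add]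
  have hbraid : altProd hΔ.simpleReflection α β (k + 1) =
      altProd hΔ.simpleReflection α β k * hΔ.simpleReflection α := by
    rw [altProd_succ]
    exact hΔ.simpleReflection_mul_of_apply_eq hB (hΔ.altProd_mem α β k) hroot
  obtain ⟨r, rfl⟩ := Nat.exists_eq_add_of_le hmk
  obtain ⟨t, ht, ht'⟩ := exists_word_altProd_mul hs hbraid r
  have := wordLength_mul_prod_le hs hv t
  rw [ht', ← mul_assoc, ← hfac, ht] at this
  omega

/-- Telescoping: appending a letter `β` to the prefix `g` adds `2 B(β, x) g β` to `x - g x`, and `g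
β` is positive because the longer word is still reduced. The first letter's term is kept apart for
use in strict estimates. -/
lemma sub_word_apply_mem_dualCone (hΔ : IsSimpleSystem B Δ) (hB : ∀ u v, B u v = B v u)
    (α : Δ) {l : List Δ}
    (hl : (α :: l).length = wordLength hΔ.simpleReflection
      (((α :: l).map hΔ.simpleReflection).prod)) {x : V} (hx : x ∈ chamber B Δ) :
    x - ((α :: l).map hΔ.simpleReflection).prod x - (2 * B α x) • (α : V) ∈ dualCone B Δ := by
  have hs := hΔ.simpleReflection_mul_self
  induction l using List.reverseRecOn with
  | nil =>
    convert zero_mem_dualCone (B := B) (Δ := Δ) using 1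
    simp [simpleReflection_apply]
  | append_singleton l β ih =>
    set g := ((α :: l).map hΔ.simpleReflection).prod with hg
    have hprod : ((α :: (l ++ [β])).map hΔ.simpleReflection).prod =
        g * hΔ.simpleReflection β := by
      rw [hg]; simp [mul_assoc]
    rw [hprod] at hl ⊢
    have hgm : g ∈ Subgroup.closure (Set.range hΔ.simpleReflection) := prod_mem_closure _
    have h1 := wordLength_mul_prod_le hs hgm [β]
    have h2 : wordLength hΔ.simpleReflection g ≤ (α :: l).length := wordLength_prod_le _
    simp only [List.map_cons, List.map_nil, List.prod_cons, List.prod_nil, mul_one,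
      List.length_cons, List.length_nil, List.length_append] at h1 h2 hl
    have hβ : g β ∈ dualCone B Δ := by
      refine hΔ.apply_mem_dualCone hB ?_ β (by omega)
      rwa [hΔ.closure_range_simpleReflection] at hgm
    have := add_mem_dualCone (ih (by rw [List.length_cons]; omega)) (smul_mem_dualCone
      (mul_nonneg zero_le_two (by rw [hB]; exact hx β β.2 : (0 : ℝ) ≤ B β x)) hβ)
    convert this using 1
    rw [LinearEquiv.mul_apply, simpleReflection_apply, map_sub, map_smul]
    module

/-- For `w ≠ 1` there is a simple root `α` such that `x - w x` exceeds `x - s_α x` by a positive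
vector, for all `x` in the fundamental chamber. -/
theorem exists_sub_apply_mem_dualCone (hΔ : IsSimpleSystem B Δ) (hB : ∀ u v, B u v = B v u)
    {w : V ≃ₗ[ℝ] V} (hw : w ∈ coxeterGroup B Δ) (h1 : w ≠ 1) :
    ∃ α ∈ Δ, ∀ x ∈ chamber B Δ, x - w x - (2 * B α x) • α ∈ dualCone B Δ := by
  rw [← hΔ.closure_range_simpleReflection] at hw
  obtain ⟨l, hl, rfl⟩ := exists_reduced_word hΔ.simpleReflection_mul_self hw
  rcases l with _ | ⟨α, l⟩
  · simp at h1
  · exact ⟨α, α.2, fun x hx => hΔ.sub_word_apply_mem_dualCone hB α hl hx⟩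

theorem sub_apply_mem_dualCone (hΔ : IsSimpleSystem B Δ) (hB : ∀ u v, B u v = B v u)
    {w : V ≃ₗ[ℝ] V} (hw : w ∈ coxeterGroup B Δ) {x : V} (hx : x ∈ chamber B Δ) :
    x - w x ∈ dualCone B Δ := by
  by_cases h1 : w = 1
  · rw [h1, LinearEquiv.coe_one, id_eq, sub_self]; exact zero_mem_dualCone
  obtain ⟨α, hα, h⟩ := hΔ.exists_sub_apply_mem_dualCone hB hw h1
  have := add_mem_dualCone (h x hx) (smul_mem_dualCone
    (mul_nonneg zero_le_two (by rw [hB]; exact hx α hα : (0 : ℝ) ≤ B α x)) (mem_dualCone hα))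
  rwa [sub_add_cancel] at this

end IsSimpleSystem

end Roots

/-! ### Hyperbolic geometry -/

section Hyperbolic

variable {V : Type*} [AddCommGroup V] [Module ℝ V] {n : ℕ} {B : LinearMap.BilinForm ℝ V}
  {b : Module.Basis (Fin (n + 1)) ℝ V}

lemma IsLorentzBasis.apply_last (hb : IsLorentzBasis B b) (v : V) :
    B (b (Fin.last n)) v = -lastCoord b v := by
  rw [hb.apply_eq]
  simp [lastCoord, Fin.ext_iff, (Fin.is_lt _).ne']

lemma IsLorentzBasis.last_mem_hyperboloid (hb : IsLorentzBasis B b) :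
    b (Fin.last n) ∈ hyperboloid B b := by
  have h : lastCoord b (b (Fin.last n)) = 1 := by simp [lastCoord]
  exact ⟨by rw [hb.apply_last, h], by rw [h]; exact one_pos⟩

lemma IsLorentzBasis.sum_sq_eq (hb : IsLorentzBasis B b) {x : V} (hx : x ∈ hyperboloid B b) :
    ∑ i : Fin n, b.repr x i.castSucc ^ 2 = lastCoord b x ^ 2 - 1 := by
  have h := hb.quad x
  rw [hx.1] at h
  rw [lastCoord]
  linarith

/-- A point of `ℍⁿ` at bounded distance from `x` has bounded last coordinate. -/
lemma IsLorentzBasis.lastCoord_le (hb : IsLorentzBasis B b) {x y : V} (hx : x ∈ hyperboloid B b)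
    (hy : y ∈ hyperboloid B b) : lastCoord b y ≤ 2 * lastCoord b x * -B x y := by
  have hcs := Finset.sum_mul_sq_le_sq_mul_sq Finset.univ
    (fun i : Fin n => b.repr x i.castSucc) (fun i : Fin n => b.repr y i.castSucc)
  rw [hb.sum_sq_eq hx, hb.sum_sq_eq hy] at hcs
  have hx1 : 0 ≤ lastCoord b x ^ 2 - 1 := by
    rw [← hb.sum_sq_eq hx]; positivity
  rw [hb.apply_eq]
  have hx0 := hx.2
  have hy0 := hy.2
  generalize ∑ i : Fin n, b.repr x i.castSucc * b.repr y i.castSucc = S at *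
  generalize lastCoord b x = p at *
  generalize lastCoord b y = r at *
  by_contra! hlt
  -- Squaring this contradicts Cauchy–Schwarz, because `(2p² - 1)² = 4p²(p² - 1) + 1`.
  have h1 : r * (2 * p ^ 2 - 1) < 2 * p * S := by linarith
  have h2 : 0 ≤ r * (2 * p ^ 2 - 1) := mul_nonneg hy0.le (by linarith)
  have h3 : (r * (2 * p ^ 2 - 1)) ^ 2 < (2 * p * S) ^ 2 := pow_lt_pow_left₀ h1 h2 two_ne_zero
  nlinarith [sq_nonneg p, sq_nonneg r, mul_le_mul_of_nonneg_left hcs (sq_nonneg p)]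

/-- The form is positive definite on the orthogonal complement of the time-like vector `e`. -/
lemma IsLorentzBasis.eq_zero_of_apply_eq_zero (hb : IsLorentzBasis B b) {v : V}
    (h0 : B v v = 0) (h1 : B (b (Fin.last n)) v = 0) : v = 0 := by
  rw [hb.apply_last, neg_eq_zero] at h1
  have h2 := hb.quad v
  rw [h0, show b.repr v (Fin.last n) = 0 from h1, zero_pow two_ne_zero, sub_zero, eq_comm,
    Finset.sum_eq_zero_iff_of_nonneg fun i _ => sq_nonneg _] at h2
  refine b.ext_elem fun i => ?_
  rw [map_zero, Finsupp.zero_apply]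
  induction i using Fin.lastCases with
  | last => exact h1
  | cast i => exact pow_eq_zero_iff two_ne_zero |>.mp (h2 i (Finset.mem_univ i))

/-- Each ball of radius `ε / 2` accounts for at most one index. Indices are counted rather than
values, so group elements are counted rather than orbit points. -/
lemma finite_of_totallyBounded_of_le_dist {X Y : Type*} [PseudoMetricSpace X] {f : Y → X}
    {S : Set Y} (hS : TotallyBounded (f '' S)) {ε : ℝ} (hε : 0 < ε)
    (hf : ∀ x ∈ S, ∀ y ∈ S, x ≠ y → ε ≤ dist (f x) (f y)) : S.Finite := by
  obtain ⟨t, ht, hcov⟩ := Metric.totallyBounded_iff.mp hS (ε / 2) (by positivity)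
  refine (ht.biUnion (t := fun c => {x ∈ S | dist (f x) c < ε / 2}) fun c _ => ?_).subset
    fun x hx => ?_
  · refine Set.Subsingleton.finite fun x hx y hy => ?_
    by_contra hne
    have := hf x hx.1 y hy.1 hne
    have := dist_triangle_right (f x) (f y) c
    linarith [hx.2, hy.2]
  · obtain ⟨c, hc, hxc⟩ := Set.mem_iUnion₂.mp (hcov ⟨x, hx, rfl⟩)
    exact Set.mem_iUnion₂.mpr ⟨c, hc, hx, hxc⟩

variable {Δ : Finset V}

lemma neg_last_mem_chamber (hneg : ∀ α ∈ Δ, B (b (Fin.last n)) α < 0) :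
    -b (Fin.last n) ∈ chamber B Δ := fun α hα => by
  rw [map_neg, LinearMap.neg_apply]; linarith [hneg α hα]

lemma mem_hyperboloid_apply (hb : IsLorentzBasis B b) (hΔ : IsSimpleSystem B Δ)
    {w : V ≃ₗ[ℝ] V} (hw : w ∈ coxeterGroup B Δ) {x : V} (hx : x ∈ hyperboloid B b) :
    w x ∈ hyperboloid B b :=
  (hyperboloidAction hb hΔ ⟨w, hw⟩ ⟨x, hx⟩).2

/-- The orbit of `eₙ₊₁` is uniformly discrete. -/
lemma exists_one_add_le_neg_apply (hb : IsLorentzBasis B b) (hΔ : IsSimpleSystem B Δ)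
    (hneg : ∀ α ∈ Δ, B (b (Fin.last n)) α < 0) :
    ∃ δ : ℝ, 0 < δ ∧ ∀ w ∈ coxeterGroup B Δ, w ≠ 1 →
      1 + δ ≤ -B (b (Fin.last n)) (w (b (Fin.last n))) := by
  set e := b (Fin.last n) with he
  have hδ : ∃ δ : ℝ, 0 < δ ∧ ∀ α ∈ Δ, δ ≤ 2 * B e α ^ 2 := by
    rcases Δ.eq_empty_or_nonempty with rfl | hne
    · exact ⟨1, one_pos, by simp⟩
    · obtain ⟨α, hα, h⟩ := Δ.exists_min_image (fun α => 2 * B e α ^ 2) hne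
      exact ⟨_, by have := (hneg α hα).ne; positivity, h⟩
  obtain ⟨δ, hδ, hle⟩ := hδ
  refine ⟨δ, hδ, fun w hw h1 => ?_⟩
  obtain ⟨α, hα, h⟩ := hΔ.exists_sub_apply_mem_dualCone hb.symm hw h1
  -- With `-e` in both slots the inequality reads `-B(e, w e) ≥ 1 + 2 B(e, α)²`.
  have h2 := h _ (neg_last_mem_chamber hneg) _ (neg_last_mem_chamber hneg)
  have h3 : B e e = -1 := hb.last_mem_hyperboloid.1
  simp only [← he, map_sub, map_neg, map_smul, LinearMap.neg_apply, smul_eq_mul, h3,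
    hb.symm α e] at h2
  linarith [hle α hα]

theorem finite_lastCoord_le (hb : IsLorentzBasis B b) (hΔ : IsSimpleSystem B Δ)
    (hneg : ∀ α ∈ Δ, B (b (Fin.last n)) α < 0) (R : ℝ) :
    {w : coxeterGroup B Δ | lastCoord b (w.1 (b (Fin.last n))) ≤ R}.Finite := by
  obtain ⟨δ, hδ, hsep⟩ := exists_one_add_le_neg_apply hb hΔ hneg
  set e := b (Fin.last n) with he
  have hmem : ∀ w : coxeterGroup B Δ, w.1 e ∈ hyperboloid B b := fun w =>
    mem_hyperboloid_apply hb hΔ w.2 hb.last_mem_hyperboloid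
  -- The form takes a value of at least `2δ` on a difference of distinct orbit points and is at most
  -- `n` times the squared sup norm. Using `n + 1` keeps the denominator positive when `n = 0`.
  refine finite_of_totallyBounded_of_le_dist (f := fun w : coxeterGroup B Δ => b.equivFun (w.1 e))
    (ε := √(2 * δ / (n + 1))) ?_ (by positivity) ?_
  · refine (isCompact_closedBall (0 : Fin (n + 1) → ℝ) R).totallyBounded.subset ?_
    rintro _ ⟨w, hw, rfl⟩
    have hw : lastCoord b (w.1 e) ≤ R := hw
    have hpos := (hmem w).2
    rw [mem_closedBall_zero_iff, pi_norm_le_iff_of_nonneg (hpos.le.trans hw)]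
    intro i
    change |b.repr (w.1 e) i| ≤ R
    induction i using Fin.lastCases with
    | last => exact (abs_of_pos hpos).trans_le hw
    | cast i =>
      refine le_trans (abs_le_of_sq_le_sq ?_ hpos.le) hw
      have h1 := hb.sum_sq_eq (hmem w)
      have h2 := Finset.single_le_sum (f := fun i : Fin n => b.repr (w.1 e) i.castSucc ^ 2)
        (fun i _ => sq_nonneg _) (Finset.mem_univ i)
      linarith
  · rintro w - w' - hne
    have hne' : (w⁻¹ * w').1 ≠ 1 := fun h => hne (inv_mul_eq_one.mp (Subtype.ext h))
    have h1 := hsep _ (w⁻¹ * w').2 hne'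
    have h2 : B e ((w⁻¹ * w').1 e) = B (w.1 e) (w'.1 e) := by
      have h := hΔ.apply_inv_apply hb.symm (inv_mem w.2) e (w'.1 e)
      rw [inv_inv] at h
      exact h.symm
    have h3 : B (w.1 e - w'.1 e) (w.1 e - w'.1 e) = -2 - 2 * B (w.1 e) (w'.1 e) := by
      simp only [map_sub, LinearMap.sub_apply, (hmem w).1, (hmem w').1, hb.symm (w'.1 e) (w.1 e)]
      ring
    rw [Real.sqrt_le_left dist_nonneg, div_le_iff₀ (by positivity), dist_eq_norm, ← map_sub]
    rw [hb.quad] at h3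
    have h4 : ∑ i : Fin n, b.repr (w.1 e - w'.1 e) i.castSucc ^ 2 ≤
        ∑ i : Fin n, ‖b.equivFun (w.1 e - w'.1 e)‖ ^ 2 := by
      refine Finset.sum_le_sum fun i _ => ?_
      rw [← sq_abs, ← Real.norm_eq_abs]
      exact pow_le_pow_left₀ (norm_nonneg _) (norm_le_pi_norm (b.equivFun _) i.castSucc) 2
    rw [Finset.sum_const, Finset.card_univ, Fintype.card_fin, nsmul_eq_mul] at h4
    nlinarith [sq_nonneg (b.repr (w.1 e - w'.1 e) (Fin.last n)),
      sq_nonneg ‖b.equivFun (w.1 e - w'.1 e)‖]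

/-- The translates of `-C` cover `ℍⁿ`. -/
theorem exists_neg_apply_mem_chamber (hb : IsLorentzBasis B b) (hΔ : IsSimpleSystem B Δ)
    (hneg : ∀ α ∈ Δ, B (b (Fin.last n)) α < 0) {x : V} (hx : x ∈ hyperboloid B b) :
    ∃ w ∈ coxeterGroup B Δ, -w x ∈ chamber B Δ := by
  have hmem : ∀ w : coxeterGroup B Δ, w.1 x ∈ hyperboloid B b := fun w =>
    mem_hyperboloid_apply hb hΔ w.2 hx
  -- The height of `w x` is `-B(w⁻¹ e, x)`, so it controls the height of `w⁻¹ e`.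
  have hfin : {w : coxeterGroup B Δ | lastCoord b (w.1 x) ≤ lastCoord b x}.Finite := by
    have h := (finite_lastCoord_le hb hΔ hneg (2 * lastCoord b x * lastCoord b x)).preimage
      (inv_injective.injOn (s := (fun w : coxeterGroup B Δ => w⁻¹) ⁻¹' _))
    refine h.subset fun w hw => ?_
    have hw : lastCoord b (w.1 x) ≤ lastCoord b x := hw
    have h1 := hb.lastCoord_le hx
      (mem_hyperboloid_apply hb hΔ (inv_mem w.2) hb.last_mem_hyperboloid)
    rw [hb.symm x, hΔ.apply_inv_apply hb.symm w.2, hb.apply_last, neg_neg] at h1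
    exact h1.trans (mul_le_mul_of_nonneg_left hw (by linarith [hx.2]))
  obtain ⟨w, hw, hmin⟩ := Set.exists_min_image _
    (fun w : coxeterGroup B Δ => lastCoord b (w.1 x)) hfin ⟨1, le_refl (lastCoord b x)⟩
  refine ⟨w, w.2, fun α hα => ?_⟩
  rw [map_neg, LinearMap.neg_apply, neg_nonneg]
  by_contra! hpos
  have hw : lastCoord b (w.1 x) ≤ lastCoord b x := hw
  have hlt : lastCoord b (hΔ.simpleReflection ⟨α, hα⟩ (w.1 x)) < lastCoord b (w.1 x) := by
    have h1 := hneg α hα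
    have h2 : B (b (Fin.last n)) (hΔ.simpleReflection ⟨α, hα⟩ (w.1 x)) =
        B (b (Fin.last n)) (w.1 x) - 2 * B (w.1 x) α * B (b (Fin.last n)) α := by
      rw [hΔ.simpleReflection_apply, map_sub, map_smul, smul_eq_mul, hb.symm α]
    rw [hb.apply_last, hb.apply_last (w.1 x)] at h2
    nlinarith
  have := hmin (⟨_, hΔ.simpleReflection_mem ⟨α, hα⟩⟩ * w) (hlt.le.trans hw)
  exact absurd hlt (not_lt.mpr this)

lemma neg_mem_titsCone (hb : IsLorentzBasis B b) (hΔ : IsSimpleSystem B Δ)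
    (hneg : ∀ α ∈ Δ, B (b (Fin.last n)) α < 0) {x : V} (hx : x ∈ hyperboloid B b) :
    -x ∈ titsCone B Δ := by
  obtain ⟨w, hw, h⟩ := exists_neg_apply_mem_chamber hb hΔ hneg hx
  refine Set.mem_iUnion₂.mpr ⟨w⁻¹, inv_mem hw, -w x, h, ?_⟩
  rw [map_neg, ← LinearEquiv.mul_apply, inv_mul_cancel, LinearEquiv.coe_one, id_eq]

lemma smul_mem_chamber {c : ℝ} (hc : 0 ≤ c) {x : V} (hx : x ∈ chamber B Δ) :
    c • x ∈ chamber B Δ := fun α hα => by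
  rw [map_smul, LinearMap.smul_apply, smul_eq_mul]; exact mul_nonneg hc (hx α hα)

lemma smul_mem_titsCone {c : ℝ} (hc : 0 ≤ c) {x : V} (hx : x ∈ titsCone B Δ) :
    c • x ∈ titsCone B Δ := by
  obtain ⟨w, hw, y, hy, rfl⟩ := Set.mem_iUnion₂.mp hx
  exact Set.mem_iUnion₂.mpr ⟨w, hw, c • y, smul_mem_chamber hc hy, map_smul _ _ _⟩

/-- Two points of `-C` in the same orbit are equal. -/
theorem apply_eq_of_neg_mem_chamber (hb : IsLorentzBasis B b) (hΔ : IsSimpleSystem B Δ)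
    (hneg : ∀ α ∈ Δ, B (b (Fin.last n)) α < 0) {w : V ≃ₗ[ℝ] V} (hw : w ∈ coxeterGroup B Δ) {x : V}
    (hx : -x ∈ chamber B Δ) (hwx : -w x ∈ chamber B Δ) : w x = x := by
  have h1 := hΔ.sub_apply_mem_dualCone hb.symm hw hx
  have h2 := hΔ.sub_apply_mem_dualCone hb.symm (inv_mem hw) hwx
  rw [map_neg, ← LinearEquiv.mul_apply, inv_mul_cancel, LinearEquiv.coe_one, id_eq] at h2
  rw [map_neg] at h1
  -- Both `w x - x` and its negative lie in the dual cone. Testing against `-x` and `-w x` shows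
  -- that the difference is isotropic, and testing against `-e` that it is orthogonal to `e`.
  have key : ∀ y ∈ chamber B Δ, B y (w x - x) = 0 := fun y hy => by
    have h1 := h1 y hy
    have h2 := h2 y hy
    simp only [map_sub, map_neg] at h1 h2 ⊢
    linarith
  have k1 := key _ hx
  have k2 := key _ hwx
  have k3 := key _ (neg_last_mem_chamber hneg)
  rw [← sub_eq_zero]
  refine hb.eq_zero_of_apply_eq_zero ?_ ?_
  · rw [map_sub B, LinearMap.sub_apply]
    rw [map_neg, LinearMap.neg_apply] at k1 k2
    linarith
  · rwa [map_neg, LinearMap.neg_apply, neg_eq_zero] at k3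

/-- The group acts freely on the interior of the chamber. -/
theorem eq_one_of_apply_eq (hΔ : IsSimpleSystem B Δ) (hB : ∀ u v, B u v = B v u)
    {w : V ≃ₗ[ℝ] V} (hw : w ∈ coxeterGroup B Δ) {x : V} (hx : ∀ α ∈ Δ, B x α < 0)
    (hwx : w x = x) : w = 1 := by
  by_contra h1
  have hxC : -x ∈ chamber B Δ := fun α hα => by
    rw [map_neg, LinearMap.neg_apply]; linarith [hx α hα]
  obtain ⟨α, hα, h⟩ := hΔ.exists_sub_apply_mem_dualCone hB hw h1
  -- Since `w` fixes `x`, only `-2 B(x, α)² ≥ 0` remains.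
  have := h _ hxC _ hxC
  simp only [map_neg, hwx, sub_self, map_sub, map_zero, map_smul, LinearMap.neg_apply, smul_eq_mul,
    hB α x] at this
  nlinarith [hx α hα]

end Hyperbolic

/-! ### Topology of the models -/

section Topology

variable {V : Type*} [AddCommGroup V] [Module ℝ V] [TopologicalSpace V] [IsTopologicalAddGroup V]
  [ContinuousSMul ℝ V] [T2Space V] {n : ℕ} {B : LinearMap.BilinForm ℝ V}
  {b : Module.Basis (Fin (n + 1)) ℝ V}

lemma continuous_linear (b : Module.Basis (Fin (n + 1)) ℝ V) (f : V →ₗ[ℝ] ℝ) : Continuous f := by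
  have := Module.Finite.of_basis b
  exact f.continuous_of_finiteDimensional

lemma continuous_lastCoord (b : Module.Basis (Fin (n + 1)) ℝ V) : Continuous (lastCoord b) :=
  continuous_linear b (b.coord (Fin.last n))

lemma IsLorentzBasis.continuous_quad (hb : IsLorentzBasis B b) : Continuous fun v => B v v := by
  simp only [hb.quad]
  have h : ∀ i, Continuous fun v => b.repr v i := fun i => continuous_linear b (b.coord i)
  fun_prop

lemma continuous_apply_left (b : Module.Basis (Fin (n + 1)) ℝ V)
    (B : LinearMap.BilinForm ℝ V) (u : V) : Continuous fun v => B v u :=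
  continuous_linear b (B.flip u)

lemma isClosed_neg_mem_chamber (b : Module.Basis (Fin (n + 1)) ℝ V)
    (B : LinearMap.BilinForm ℝ V) (Δ : Finset V) :
    IsClosed {v : V | v ∈ -chamber B Δ} := by
  have : {v : V | v ∈ -chamber B Δ} = ⋂ α ∈ Δ, {v | B v α ≤ 0} := by
    ext v; simp [chamber]
  rw [this]
  exact isClosed_biInter fun α _ => isClosed_le (continuous_apply_left b B α) continuous_const

/-- Points of `ℍⁿ` can be moved in any direction `u`. -/
lemma exists_smul_add_smul_mem (hb : IsLorentzBasis B b) (x : hyperboloid B b) (u : V)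
    {U : Set (hyperboloid B b)} (hU : U ∈ nhds x) :
    ∃ t : ℝ, 0 < t ∧ ∃ c : ℝ, 0 < c ∧ ∃ z ∈ U, (z : V) = c • ((x : V) + t • u) := by
  obtain ⟨U', hU', hsub⟩ := mem_nhds_subtype _ _ _ |>.mp hU
  have hγ : Continuous fun t : ℝ => (x : V) + t • u := by fun_prop
  have hq := hb.continuous_quad.comp hγ
  have h0 : B ((x : V) + (0 : ℝ) • u) ((x : V) + (0 : ℝ) • u) = -1 := by
    rw [zero_smul, add_zero]; exact x.2.1
  -- The segment `x + t u` is rescaled back to the hyperboloid; the resulting curve is continuous at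
  -- `0` and starts at `x`.
  have hψ : ContinuousAt (fun t : ℝ =>
      (√(-B ((x : V) + t • u) ((x : V) + t • u)))⁻¹ • ((x : V) + t • u)) 0 := by
    refine ContinuousAt.smul (ContinuousAt.inv₀ ?_ ?_) hγ.continuousAt
    · exact (Real.continuous_sqrt.comp hq.neg).continuousAt
    · rw [h0]; simp
  have e1 : ∀ᶠ t : ℝ in nhds 0,
      (√(-B ((x : V) + t • u) ((x : V) + t • u)))⁻¹ • ((x : V) + t • u) ∈ U' := by
    refine hψ ?_
    beta_reduce
    rw [h0]
    simpa using hU'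
  have e2 : ∀ᶠ t : ℝ in nhds 0, B ((x : V) + t • u) ((x : V) + t • u) < 0 :=
    hq.continuousAt.eventually_lt continuousAt_const (by simp only [Function.comp, h0]; norm_num)
  have e3 : ∀ᶠ t : ℝ in nhds 0, 0 < lastCoord b ((x : V) + t • u) :=
    continuousAt_const.eventually_lt ((continuous_lastCoord b).comp hγ).continuousAt
      (by simpa using x.2.2)
  obtain ⟨t, ⟨h1, h2, h3⟩, ht⟩ := (((e1.and (e2.and e3)).filter_mono nhdsWithin_le_nhds).and
    (self_mem_nhdsWithin (s := Set.Ioi (0 : ℝ)))).exists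
  set y := (x : V) + t • u with hy
  have hs : 0 < √(-B y y) := Real.sqrt_pos.mpr (by linarith)
  have hss : √(-B y y) * √(-B y y) = -B y y := Real.mul_self_sqrt (by linarith)
  have hz : (√(-B y y))⁻¹ • y ∈ hyperboloid B b := by
    refine ⟨?_, ?_⟩
    · rw [map_smul, map_smul, LinearMap.smul_apply, smul_eq_mul, smul_eq_mul]
      have : B y y = -(√(-B y y) * √(-B y y)) := by linarith
      generalize √(-B y y) = s at *
      rw [this]; field_simp
    · rw [lastCoord_smul]; positivity
  exact ⟨t, ht, _, inv_pos.mpr hs, ⟨_, hz⟩, hsub h1, rfl⟩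

variable {Δ : Finset V}

/-- From a point on the wall of `α`, an arbitrarily small move in direction `α` leaves `-C`, because
`B(α, α) = 1`. -/
lemma interior_chamber_eq (hb : IsLorentzBasis B b) (hΔ : IsSimpleSystem B Δ) :
    interior {v : hyperboloid B b | (v : V) ∈ -chamber B Δ} =
      {v : hyperboloid B b | ∀ α ∈ Δ, B v α < 0} := by
  apply Set.Subset.antisymm
  · intro x hx α hα
    have hle : ∀ z : hyperboloid B b, (z : V) ∈ -chamber B Δ → B z α ≤ 0 := fun z hz => by
      have := hz α hα
      rwa [map_neg, LinearMap.neg_apply, neg_nonneg] at this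
    have hsub := interior_subset (s := {v : hyperboloid B b | (v : V) ∈ -chamber B Δ})
    refine lt_of_le_of_ne (hle x (hsub hx)) fun h0 => ?_
    obtain ⟨t, ht, c, hc, z, hz, hzx⟩ :=
      exists_smul_add_smul_mem hb x α (mem_interior_iff_mem_nhds.mp hx)
    have := hle z hz
    rw [hzx, map_smul, map_add, map_smul, LinearMap.smul_apply, LinearMap.add_apply,
      LinearMap.smul_apply, h0, hΔ.apply_self α hα, smul_eq_mul, smul_eq_mul, zero_add,
      mul_one] at this
    nlinarith
  · refine interior_maximal (fun x hx α hα => ?_) ?_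
    · rw [map_neg, LinearMap.neg_apply]; linarith [hx α hα]
    · have : {v : hyperboloid B b | ∀ α ∈ Δ, B v α < 0} =
          ⋂ α ∈ Δ, {v : hyperboloid B b | B v α < 0} := by
        ext v; simp
      rw [this]
      exact isOpen_biInter_finset fun α _ => isOpen_lt
        ((continuous_apply_left b B α).comp continuous_subtype_val) continuous_const

/-- Moving a point of `-C` towards `e` makes all wall inequalities strict at once. -/
lemma closure_interior_chamber (hb : IsLorentzBasis B b) (hΔ : IsSimpleSystem B Δ)
    (hneg : ∀ α ∈ Δ, B (b (Fin.last n)) α < 0) :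
    closure (interior {v : hyperboloid B b | (v : V) ∈ -chamber B Δ}) =
      {v : hyperboloid B b | (v : V) ∈ -chamber B Δ} := by
  apply Set.Subset.antisymm
  · exact closure_minimal interior_subset
      ((isClosed_neg_mem_chamber b B Δ).preimage continuous_subtype_val)
  · intro x hx
    rw [mem_closure_iff_nhds]
    intro U hU
    obtain ⟨t, ht, c, hc, z, hz, hzx⟩ := exists_smul_add_smul_mem hb x (b (Fin.last n)) hU
    refine ⟨z, hz, ?_⟩
    rw [interior_chamber_eq hb hΔ]
    intro α hα
    have h1 := hx α hα
    have h2 := hneg α hα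
    rw [map_neg, LinearMap.neg_apply, neg_nonneg] at h1
    rw [hzx, map_smul, map_add, map_smul, LinearMap.smul_apply, LinearMap.add_apply,
      LinearMap.smul_apply, smul_eq_mul, smul_eq_mul]
    exact mul_neg_of_pos_of_neg hc (by nlinarith)

/-- A point `z` of `-C` is lowest in its orbit. If `w z` has height below `R`, so has `z`, and `w e`
then has height at most `2 R²`. -/
lemma locallyFinite_chamber (hb : IsLorentzBasis B b) (hΔ : IsSimpleSystem B Δ)
    (hneg : ∀ α ∈ Δ, B (b (Fin.last n)) α < 0) :
    LocallyFinite fun w => hyperboloidAction hb hΔ w ''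
      {v : hyperboloid B b | (v : V) ∈ -chamber B Δ} := by
  intro x
  set R := lastCoord b (x : V) + 1
  refine ⟨{y | lastCoord b (y : V) < R}, ?_, ?_⟩
  · exact (isOpen_lt ((continuous_lastCoord b).comp continuous_subtype_val)
      continuous_const).mem_nhds (by simp [R])
  · refine (finite_lastCoord_le hb hΔ hneg (2 * R * R)).subset ?_
    rintro w ⟨_, ⟨z, hz, rfl⟩, hy⟩
    have hy : lastCoord b (w.1 z.1) < R := hy
    have h1 := hb.lastCoord_le (mem_hyperboloid_apply hb hΔ w.2 z.2)
      (mem_hyperboloid_apply hb hΔ w.2 hb.last_mem_hyperboloid)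
    rw [hΔ.apply_apply hb.symm w.2, hb.symm, hb.apply_last, neg_neg] at h1
    have h2 := hΔ.sub_apply_mem_dualCone hb.symm w.2 hz _ (neg_last_mem_chamber hneg)
    simp only [map_neg, map_sub, LinearMap.neg_apply, hb.apply_last] at h2
    have h3 := z.2.2
    have h4 := (mem_hyperboloid_apply hb hΔ w.2 z.2).2
    refine h1.trans ?_
    rw [mul_assoc, mul_assoc]
    exact mul_le_mul_of_nonneg_left (mul_le_mul hy.le (by linarith) h3.le (by linarith)) zero_le_two

theorem isFundamentalDomain_hyperboloid (hb : IsLorentzBasis B b) (hΔ : IsSimpleSystem B Δ)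
    (hneg : ∀ α ∈ Δ, B (b (Fin.last n)) α < 0) :
    IsFundamentalDomain (hyperboloidAction hb hΔ)
      {v : hyperboloid B b | (v : V) ∈ -chamber B Δ} where
  isClosed := (isClosed_neg_mem_chamber b B Δ).preimage continuous_subtype_val
  closure_interior := closure_interior_chamber hb hΔ hneg
  covers := by
    refine Set.eq_univ_of_forall fun x => ?_
    obtain ⟨w, hw, h⟩ := exists_neg_apply_mem_chamber hb hΔ hneg x.2
    refine Set.mem_iUnion.mpr ⟨⟨w, hw⟩⁻¹, hyperboloidAction hb hΔ ⟨w, hw⟩ x, h, ?_⟩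
    rw [← Equiv.Perm.mul_apply, ← map_mul, inv_mul_cancel, map_one, Equiv.Perm.one_apply]
  unique x hx w hwx := Subtype.ext (apply_eq_of_neg_mem_chamber hb hΔ hneg w.2 hx hwx)
  disjoint w h1 := by
    rw [Set.disjoint_right]
    rintro _ ⟨x, hx, rfl⟩ hwx
    have hsub := interior_subset (s := {v : hyperboloid B b | (v : V) ∈ -chamber B Δ})
    have hxw := apply_eq_of_neg_mem_chamber hb hΔ hneg w.2 (hsub hx) (hsub hwx)
    rw [interior_chamber_eq hb hΔ] at hx
    exact h1 (Subtype.ext (eq_one_of_apply_eq hΔ hb.symm w.2 hx hxw))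
  locallyFinite := locallyFinite_chamber hb hΔ hneg

/-- The radial projection is a homeomorphism. -/
def radialHomeomorph (hb : IsLorentzBasis B b) : projModel b ≃ₜ hyperboloid B b where
  toEquiv := radialProjection hb
  continuous_toFun := by
    refine Continuous.subtype_mk (Continuous.smul (Continuous.inv₀ ?_ fun v => ?_)
      continuous_subtype_val) _
    · exact Real.continuous_sqrt.comp
        (continuous_abs.comp (hb.continuous_quad.comp continuous_subtype_val))
    · exact (Real.sqrt_pos.mpr (abs_pos.mpr (hb.quad_projModel v.2).ne)).ne'
  continuous_invFun := by
    refine Continuous.subtype_mk (Continuous.smul (Continuous.inv₀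
      ((continuous_lastCoord b).comp continuous_subtype_val) fun v => v.2.2.ne')
      continuous_subtype_val) _

/-- Fundamental domains are transported by equivariant homeomorphisms. -/
lemma IsFundamentalDomain.preimage {X Y G : Type*} [TopologicalSpace X] [TopologicalSpace Y]
    [Group G] {ρ : G →* Equiv.Perm Y} {σ : G →* Equiv.Perm X} {D : Set Y}
    (h : IsFundamentalDomain ρ D) (φ : X ≃ₜ Y) (hφ : ∀ g x, φ (σ g x) = ρ g (φ x)) :
    IsFundamentalDomain σ (φ ⁻¹' D) := by
  have himg : ∀ g (A : Set Y), σ g '' (φ ⁻¹' A) = φ ⁻¹' (ρ g '' A) := fun g A => by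
    ext x
    constructor
    · rintro ⟨y, hy, rfl⟩
      exact ⟨φ y, hy, (hφ g y).symm⟩
    · rintro ⟨y, hy, hyx⟩
      refine ⟨φ.symm y, by simpa using hy, φ.injective ?_⟩
      rw [hφ, φ.apply_symm_apply, hyx]
  refine ⟨h.isClosed.preimage φ.continuous, ?_, ?_, fun x hx g hg => ?_, fun g hg => ?_, ?_⟩
  · rw [← φ.preimage_interior, ← φ.preimage_closure, h.closure_interior]
  · simp only [himg]
    rw [← Set.preimage_iUnion, h.covers, Set.preimage_univ]
  · exact φ.injective ((hφ g x).trans (h.unique _ hx g (by rw [← hφ]; exact hg)))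
  · rw [← φ.preimage_interior, himg]
    exact (h.disjoint g hg).preimage φ
  · simp only [himg]
    exact h.locallyFinite.preimage_continuous φ.continuous

theorem isFundamentalDomain_projModel (hb : IsLorentzBasis B b) (hΔ : IsSimpleSystem B Δ)
    (hneg : ∀ α ∈ Δ, B (b (Fin.last n)) α < 0) :
    IsFundamentalDomain (projAction hb hΔ) {v : projModel b | (v : V) ∈ -chamber B Δ} := by
  have h := (isFundamentalDomain_hyperboloid hb hΔ hneg).preimage (σ := projAction hb hΔ)
    (radialHomeomorph hb) fun w v => (radialProjection hb).apply_symm_apply _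
  -- Since `C` is stable under positive scaling, the preimage under the radial projection is again
  -- the trace of `-C`.
  convert h using 1
  ext v
  have hs : 0 < (√|B v.1 v.1|)⁻¹ :=
    inv_pos.mpr (Real.sqrt_pos.mpr (abs_pos.mpr (hb.quad_projModel v.2).ne))
  change -v.1 ∈ chamber B Δ ↔ -((√|B v.1 v.1|)⁻¹ • v.1) ∈ chamber B Δ
  rw [← smul_neg]
  refine ⟨smul_mem_chamber hs.le, fun hv => ?_⟩
  have := smul_mem_chamber (inv_pos.mpr hs).le hv
  rwa [smul_smul, inv_mul_cancel₀ hs.ne', one_smul] at this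

end Topology

end

end LorentzCoxeter

theorem proposition3p3 {V : Type*} [AddCommGroup V] [Module ℝ V] [TopologicalSpace V]
    [IsTopologicalAddGroup V] [ContinuousSMul ℝ V] [T2Space V] {n : ℕ}
    (B : LinearMap.BilinForm ℝ V) (b : Module.Basis (Fin (n + 1)) ℝ V)
    (hb : LorentzCoxeter.IsLorentzBasis B b) (Φ : Set V) (Δ : Finset V)
    (hΦ : LorentzCoxeter.IsBasedRootSystem B Φ Δ)
    (hneg : ∀ α ∈ Δ, B (b (Fin.last n)) α < 0) :
    (-LorentzCoxeter.titsCone B Δ ∩ LorentzCoxeter.hyperboloid B b =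
        LorentzCoxeter.hyperboloid B b ∧
      -LorentzCoxeter.titsCone B Δ ∩ LorentzCoxeter.projModel b =
        LorentzCoxeter.projModel b) ∧
    LorentzCoxeter.IsFundamentalDomain (LorentzCoxeter.hyperboloidAction hb hΦ.simple)
      {v : LorentzCoxeter.hyperboloid B b | (v : V) ∈ -LorentzCoxeter.chamber B Δ} ∧
    LorentzCoxeter.IsFundamentalDomain (LorentzCoxeter.projAction hb hΦ.simple)
      {v : LorentzCoxeter.projModel b | (v : V) ∈ -LorentzCoxeter.chamber B Δ} := by
  have hΔ := hΦ.simple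
  refine ⟨⟨?_, ?_⟩, LorentzCoxeter.isFundamentalDomain_hyperboloid hb hΔ hneg,
    LorentzCoxeter.isFundamentalDomain_projModel hb hΔ hneg⟩
  · exact Set.inter_eq_right.mpr fun x hx => LorentzCoxeter.neg_mem_titsCone hb hΔ hneg hx
  · refine Set.inter_eq_right.mpr fun x hx => ?_
    have hs : 0 < √|B x x| := Real.sqrt_pos.mpr (abs_pos.mpr (hb.quad_projModel hx).ne)
    have h := LorentzCoxeter.smul_mem_titsCone hs.le (LorentzCoxeter.neg_mem_titsCone hb hΔ hneg
      (LorentzCoxeter.radialProjection hb ⟨x, hx⟩).2)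
    change √|B x x| • -((√|B x x|)⁻¹ • x) ∈ _ at h
    rwa [smul_neg, smul_smul, mul_inv_cancel₀ hs.ne', one_smul] at h
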